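/- Consider anonymous networks in the deterministic content-oblivious model. The network is a finite simple graph $G=(V,E)$. A node of degree $d$ has ports $0,\dots,d-1$, which are put in bijection with its neighbors in an arbitrary way. Nodes have no identifiers, and they communicate only by sending contentless pulses to neighbors. The model is asynchronous: every pulse sent is eventually delivered, but delays are arbitrary. A node acts only when the algorithm is initiated and when it receives a pulse; it notices the port at which the pulse arrives, and local computation is instantaneous and unrestricted. All nodes run the same program, so the pulses sent by a node and its decision to commit to an output ($\mathsf{Leader}$ or $\mathsf{Non\text{-}Leader}$) and halt are functions of its degree, of the advice given to all nodes, and of the sequence of ports at which it has received pulses so far. The nodes have topology knowledge: the advice, the same for all nodes, is a graph with vertex set $\{0,\dots,n-1\}$ isomorphic to $G$ (a node is not told to which vertex it corresponds). A graph $G$ is symmetric about an edge $e=\{u,v\}$ if $G-e$ has exactly two connected components $H\ni u$ and $K\ni v$, and there is a graph isomorphism $f:H\to K$ with $f(u)=v$. **Theorem.** There are a content-oblivious, anonymous, deterministic algorithm with topology knowledge and a constant $C$ such that the following holds for every $n$, every tree $G$ with $n$ nodes that is not symmetric about any of its edges, every choice of the port numbering, every labeling of the advice graph, and every asynchronous execution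 of the algorithm on $G$: 1. (leader election) eventually exactly one node has committed to the output $\mathsf{Leader}$ and all other nodes have committed to $\mathsf{Non\text{-}Leader}$; 2. (quiescent termination) after some finite time all nodes have halted, and no node ever receives a pulse after it has halted; 3. (message complexity) the total number of pulses sent by all nodes is at most $C\,n^2$. -/

import Mathlib

namespace ContentOblivious

universe u

/-- `G` is symmetric about the edge `{u, v}`: removing the edge leaves exactly two connected
components, one containing `u` and the other containing `v`, and there is a graph isomorphism
between these components that maps `u` to `v`. -/
def SymmetricAbout {V : Type u} (G : SimpleGraph V) (u v : V) : Prop :=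
  G.Adj u v ∧
  ∃ (H K : (G.deleteEdges {s(u, v)}).ConnectedComponent) (hu : u ∈ H) (hv : v ∈ K),
    H ≠ K ∧ (∀ c : (G.deleteEdges {s(u, v)}).ConnectedComponent, c = H ∨ c = K) ∧
    ∃ f : H.toSimpleGraph ≃g K.toSimpleGraph, f ⟨u, hu⟩ = ⟨v, hv⟩

/-- A port numbering of a (locally finite) network: node `v` has `deg v` ports, numbered
`0, …, deg v - 1`, and `nbr v p` is the neighbor of `v` at the other end of port `p`. -/
structure PortNumbering {V : Type u} (G : SimpleGraph V) where
  deg : V → ℕ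
  nbr : (v : V) → Fin (deg v) ≃ G.neighborSet v

/-- The two possible decisions of a node. -/
inductive Output where
  | leader
  | nonLeader

/-- A deterministic, anonymous, content-oblivious algorithm. The behavior of a node is a function
of its number `d` of ports and of the list `h` of the ports at which it has received pulses so far
(in chronological order, most recent last); `h = []` stands for the initiation of the algorithm.
* `send d h p` is the number of pulses that the node sends through port `p` in reaction to the
  last event of `h`;
* `decision d h` is `some o` if, after that reaction, the node commits to the output `o` and halts,
  and `none` if it goes on. -/
structure Algorithm where
  send : (d : ℕ) → List (Fin d) → Fin d → ℕ
  decision : (d : ℕ) → List (Fin d) → Option Output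

/-- A global configuration of the network: `hist v` is the list of the ports at which `v` has
received pulses (before halting), `transit a b` is the number of pulses on their way from `a` to
`b`, and `sent` is the total number of pulses sent so far by all nodes. -/
structure Config {V : Type u} {G : SimpleGraph V} (P : PortNumbering G) where
  hist : (v : V) → List (Fin (P.deg v))
  transit : V → V → ℕ
  sent : ℕ

section Dynamics

variable {V : Type u} [Fintype V] [DecidableEq V] {G : SimpleGraph V}

/-- If `a` sends `s q` pulses through each of its ports `q`, the number of these pulses that are
sent to `b`. -/
def emitted (P : PortNumbering G) (a : V) (s : Fin (P.deg a) → ℕ) (b : V) : ℕ :=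
  ∑ q : Fin (P.deg a), if (P.nbr a q : V) = b then s q else 0

/-- The output of `v` in a configuration: `some o` if `v` has committed to `o` and halted. -/
def Config.output {P : PortNumbering G} (A : Algorithm) (c : Config P) (v : V) : Option Output :=
  A.decision (P.deg v) (c.hist v)

/-- `v` has committed to an output and halted. -/
def Config.Halted {P : PortNumbering G} (A : Algorithm) (c : Config P) (v : V) : Prop :=
  (c.output A v).isSome = true

/-- The configuration right after all nodes have initiated the algorithm. -/
def initial (A : Algorithm) (P : PortNumbering G) : Config P where
  hist := fun _ => []
  transit := fun a b => emitted P a (A.send (P.deg a) []) b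
  sent := ∑ v : V, ∑ q : Fin (P.deg v), A.send (P.deg v) [] q

/-- The configuration after one pulse is delivered to `v` at its port `p`. If `v` has halted, the
pulse is ignored. Otherwise `v` records it and sends pulses as the algorithm prescribes. -/
def deliver {P : PortNumbering G} (A : Algorithm) (c : Config P) (v : V) (p : Fin (P.deg v)) :
    Config P :=
  let s : Fin (P.deg v) → ℕ :=
    if (c.output A v).isSome then 0 else A.send (P.deg v) (c.hist v ++ [p])
  { hist :=
      if (c.output A v).isSome then c.hist else Function.update c.hist v (c.hist v ++ [p])
    transit := fun a b =>
      (if a = (P.nbr v p : V) ∧ b = v then c.transit a b - 1 else c.transit a b) +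
        (if a = v then emitted P v s b else 0)
    sent := c.sent + ∑ q : Fin (P.deg v), s q }

/-- An asynchronous execution of `A`. At each time step either one pulse in transit is delivered
(`event t = some ⟨v, p⟩`: to `v`, at its port `p`) or nothing happens (`event t = none`). The
delays are arbitrary, but every pulse is eventually delivered. -/
structure Execution (A : Algorithm) (P : PortNumbering G) where
  config : ℕ → Config P
  event : ℕ → Option ((v : V) × Fin (P.deg v))
  config_zero : config 0 = initial A P
  config_idle : ∀ t, event t = none → config (t + 1) = config t
  config_deliver : ∀ t v p, event t = some ⟨v, p⟩ →
    0 < (config t).transit (P.nbr v p) v ∧ config (t + 1) = deliver A (config t) v p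
  eventually_delivered : ∀ t v p, 0 < (config t).transit (P.nbr v p) v →
    ∃ t', t ≤ t' ∧ event t' = some ⟨v, p⟩

/-- Eventually exactly one node has output `leader`, and all others have output `nonLeader`
(outputs are committed). -/
def Execution.ElectsLeader {A : Algorithm} {P : PortNumbering G} (E : Execution A P) : Prop :=
  ∃ t : ℕ, ∃ l : V, (E.config t).output A l = some Output.leader ∧
    ∀ v : V, v ≠ l → (E.config t).output A v = some Output.nonLeader

/-- After some finite time all nodes have halted, and no node ever receives a pulse after it has
halted. -/
def Execution.QuiescentlyTerminates {A : Algorithm} {P : PortNumbering G} (E : Execution A P) :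
    Prop :=
  (∃ t : ℕ, ∀ v : V, (E.config t).Halted A v) ∧
    ∀ t v p, E.event t = some ⟨v, p⟩ → ¬ (E.config t).Halted A v

/-- The total number of pulses sent in the execution is at most `M`. -/
def Execution.PulsesAtMost {A : Algorithm} {P : PortNumbering G} (E : Execution A P) (M : ℕ) :
    Prop :=
  ∀ t : ℕ, (E.config t).sent ≤ M

end Dynamics

end ContentOblivious

/-! Deleting an edge `{u, v}` of a tree leaves a branch at `u` and a branch at `v`. The rooted
isomorphism type of a branch is coded by its Matula number, the product of the primes indexed by the
codes of the child branches. This number is monotone in the children's codes, strictly larger than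
each of them, and a complete invariant. Hence, without a symmetric edge, the two codes on every edge
differ (`branchCode_ne_swap`). Orienting edges from the smaller to the larger code gives each node
at most one outgoing edge and yields a unique sink, the future leader. Replacing codes by their
ranks among all directed edges keeps the order and bounds the values by `2n`.

A node tries to tell each neighbor, in unary, the rank of its branch away from that neighbor. Counts
only grow and the end of a number is not visible, so it sends the largest rank justified by the
pulses received at its other ports (`flow`). By monotonicity, the count received along an oriented
edge never exceeds the true rank (`Consistent.le_branchRank`), and it equals that rank once nothing
is in transit (`eq_branchRank_of_forall_eq_target`). The sink elects itself when its counts match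
its ranks; no other node can be deceived (`not_detects`). It then tops up every port to `2n + 1`
pulses, a number that no rank reaches, and this announcement travels down the tree.

Quiescence rests on the strictness of the code: a full rank sent to the parent shows that all child
ranks arrived in full. Inductively from the sink, a node that has decided has nothing left to
receive (`Consistent.eq_of_decided`). Each of the `2(n - 1)` directed edges carries at most `2n + 1`
pulses. -/

namespace ContentOblivious

universe u

/-! ### Branches of a tree and their rooted isomorphisms. -/

section Branches

variable {V : Type u} {G : SimpleGraph V} {u v u' v' x y c : V}

/-- The vertices that are reachable from `u` without using the edge `{u, v}`. -/
def branch (G : SimpleGraph V) (u v : V) : Set V :=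
  {x | (G.deleteEdges {s(u, v)}).Reachable u x}

theorem root_mem_branch (G : SimpleGraph V) (u v : V) : u ∈ branch G u v :=
  SimpleGraph.Reachable.refl _

theorem mem_branch_of_adj (hx : x ∈ branch G u v) (hxy : G.Adj x y) (hne : s(x, y) ≠ s(u, v)) :
    y ∈ branch G u v := by
  refine SimpleGraph.Reachable.trans (show SimpleGraph.Reachable _ u x from hx)
    (SimpleGraph.Adj.reachable ?_)
  simpa [SimpleGraph.deleteEdges_adj] using ⟨hxy, by simpa using hne⟩

theorem branch_induction {p : V → Prop} (root : p u)
    (step : ∀ x y, x ∈ branch G u v → p x → G.Adj x y → s(x, y) ≠ s(u, v) → p y) :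
    ∀ x ∈ branch G u v, p x := by
  intro x hx
  have h := (SimpleGraph.reachable_iff_reflTransGen _ _).1 hx
  induction h with
  | refl => exact root
  | tail h1 h2 ih =>
    rw [SimpleGraph.deleteEdges_adj] at h2
    have hb := (SimpleGraph.reachable_iff_reflTransGen _ _).2 h1
    exact step _ _ hb (ih hb) h2.1 (by simpa using h2.2)

theorem not_mem_branch (hG : G.IsAcyclic) (h : G.Adj u v) : v ∉ branch G u v :=
  SimpleGraph.isBridge_iff.1 (SimpleGraph.isAcyclic_iff_forall_adj_isBridge.1 hG h)

theorem eq_of_adj_of_mem_branch (hG : G.IsAcyclic) (h : G.Adj u v) (hx : x ∈ branch G u v)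
    (hy : y ∉ branch G u v) (hxy : G.Adj x y) : x = u ∧ y = v := by
  by_contra hne
  by_cases hs : s(x, y) = s(u, v)
  · rcases Sym2.eq_iff.1 hs with h1 | ⟨rfl, rfl⟩
    · exact hne h1
    · exact not_mem_branch hG h hx
  · exact hy (mem_branch_of_adj hx hxy hs)

theorem branch_subset (hG : G.IsAcyclic) (hc : G.Adj u c) (hcv : c ≠ v) :
    branch G c u ⊆ branch G u v := by
  refine branch_induction ?_ ?_
  · refine mem_branch_of_adj (root_mem_branch G u v) hc fun h => ?_
    rcases Sym2.eq_iff.1 h with ⟨-, h⟩ | ⟨-, h⟩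
    · exact hcv h
    · exact hc.ne' h
  · intro x y hx hxu hxy hne
    refine mem_branch_of_adj hxu hxy fun h => ?_
    rcases Sym2.eq_iff.1 h with ⟨rfl, -⟩ | ⟨-, rfl⟩
    · exact not_mem_branch hG hc.symm hx
    · exact not_mem_branch hG hc.symm (mem_branch_of_adj hx hxy hne)

theorem branch_ssubset (hG : G.IsAcyclic) (hc : G.Adj u c) (hcv : c ≠ v) :
    branch G c u ⊂ branch G u v :=
  ⟨branch_subset hG hc hcv, fun h => not_mem_branch hG hc.symm (h (root_mem_branch G u v))⟩

theorem exists_mem_branch (hG : G.IsAcyclic) :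
    ∀ x ∈ branch G u v, x = u ∨ ∃ c, (G.Adj u c ∧ c ≠ v) ∧ x ∈ branch G c u := by
  refine branch_induction (Or.inl rfl) ?_
  rintro x y - (rfl | ⟨c, hc, hx⟩) hxy hne
  · exact Or.inr ⟨y, ⟨hxy, fun h => hne (by rw [h])⟩, root_mem_branch G y x⟩
  · by_cases hy : y ∈ branch G c u
    · exact Or.inr ⟨c, hc, hy⟩
    · exact Or.inl (eq_of_adj_of_mem_branch hG hc.1.symm hx hy hxy).2

theorem branch_unique (hG : G.IsAcyclic) {c c' : V} (hc : G.Adj u c) (hc' : G.Adj u c')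
    (hx : x ∈ branch G c u) (hx' : x ∈ branch G c' u) : c = c' := by
  by_contra hne
  refine branch_induction (p := fun x => x ∉ branch G c u) ?_ ?_ x hx' hx
  · intro h
    exact hne (eq_of_adj_of_mem_branch hG hc.symm h (not_mem_branch hG hc.symm) hc'.symm).1.symm
  · intro x y hx1 hx2 hxy _ hy
    have h := (eq_of_adj_of_mem_branch hG hc.symm hy hx2 hxy.symm).2
    exact not_mem_branch hG hc'.symm (h ▸ hx1)

theorem mem_branch_or_mem_branch (hG : G.Connected) (x : V) :
    x ∈ branch G u v ∨ x ∈ branch G v u := by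
  have h := (SimpleGraph.reachable_iff_reflTransGen _ _).1 (hG.preconnected u x)
  induction h with
  | refl => exact Or.inl (root_mem_branch G u v)
  | @tail y z _ h2 ih =>
    by_cases hs : s(y, z) = s(u, v)
    · rcases Sym2.eq_iff.1 hs with ⟨-, rfl⟩ | ⟨-, rfl⟩
      · exact Or.inr (root_mem_branch G _ _)
      · exact Or.inl (root_mem_branch G _ _)
    · refine ih.imp (fun h => mem_branch_of_adj h h2 hs) fun h => mem_branch_of_adj h h2 ?_
      rwa [Sym2.eq_swap (a := v)]

/-- Isomorphisms between the branches at `u` and at `u'` that respect the roots are assembled from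
such isomorphisms between the branches at their neighbors. -/
theorem exists_bijOn_branch_of_children (hG : G.IsAcyclic) (h : G.Adj u v) (h' : G.Adj u' v')
    (σ : {c // G.Adj u c ∧ c ≠ v} ≃ {c // G.Adj u' c ∧ c ≠ v'})
    (H : ∀ c, ∃ f : V → V, Set.BijOn f (branch G c.1 u) (branch G (σ c).1 u') ∧ f c.1 = (σ c).1 ∧
      ∀ x ∈ branch G c.1 u, ∀ y ∈ branch G c.1 u, G.Adj x y ↔ G.Adj (f x) (f y)) :
    ∃ f : V → V, Set.BijOn f (branch G u v) (branch G u' v') ∧ f u = u' ∧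
      ∀ x ∈ branch G u v, ∀ y ∈ branch G u v, G.Adj x y ↔ G.Adj (f x) (f y) := by
  classical
  choose F hF hroot hadj using H
  -- The child branches are pairwise disjoint and avoid `u`, so the choice of `c` is forced and the
  -- default value `u'` is taken at `u`.
  let f : V → V := fun x =>
    if hx : ∃ c : {c // G.Adj u c ∧ c ≠ v}, x ∈ branch G c.1 u then F hx.choose x else u'
  have hfu : f u = u' := by
    refine dif_neg ?_
    rintro ⟨c, hc⟩
    exact not_mem_branch hG c.2.1.symm hc
  have hfc : ∀ c : {c // G.Adj u c ∧ c ≠ v}, ∀ x ∈ branch G c.1 u, f x = F c x := by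
    intro c x hx
    have hex : ∃ c : {c // G.Adj u c ∧ c ≠ v}, x ∈ branch G c.1 u := ⟨c, hx⟩
    have heq : hex.choose = c :=
      Subtype.ext (branch_unique hG hex.choose.2.1 c.2.1 hex.choose_spec hx)
    simp only [f, dif_pos hex, heq]
  clear_value f
  have hmaps : ∀ c : {c // G.Adj u c ∧ c ≠ v}, ∀ x ∈ branch G c.1 u,
      f x ∈ branch G (σ c).1 u' := by
    intro c x hx
    rw [hfc c x hx]
    exact (hF c).mapsTo hx
  have hne : ∀ c : {c // G.Adj u c ∧ c ≠ v}, ∀ x ∈ branch G c.1 u, f x ≠ u' := by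
    intro c x hx hfx
    exact not_mem_branch hG (σ c).2.1.symm (hfx ▸ hmaps c x hx)
  have hrootadj : ∀ c : {c // G.Adj u c ∧ c ≠ v}, ∀ y ∈ branch G c.1 u,
      (G.Adj y u ↔ G.Adj (f y) u') := by
    intro c y hy
    constructor
    · intro hyu
      have := (eq_of_adj_of_mem_branch hG c.2.1.symm hy (not_mem_branch hG c.2.1.symm) hyu).1
      rw [hfc c y hy, this, hroot]
      exact (σ c).2.1.symm
    · intro hyu
      have h1 := (eq_of_adj_of_mem_branch hG (σ c).2.1.symm (hmaps c y hy)
        (not_mem_branch hG (σ c).2.1.symm) hyu).1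
      rw [hfc c y hy, ← hroot] at h1
      rw [(hF c).injOn hy (root_mem_branch G _ _) h1]
      exact c.2.1.symm
  refine ⟨f, ⟨?_, ?_, ?_⟩, hfu, ?_⟩
  · intro x hx
    rcases exists_mem_branch hG x hx with rfl | ⟨c, hc, hxc⟩
    · rw [hfu]
      exact root_mem_branch G _ _
    · exact branch_subset hG (σ ⟨c, hc⟩).2.1 (σ ⟨c, hc⟩).2.2 (hmaps ⟨c, hc⟩ x hxc)
  · intro x hx y hy hxy
    rcases exists_mem_branch hG x hx with rfl | ⟨c, hc, hxc⟩ <;>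
      rcases exists_mem_branch hG y hy with rfl | ⟨d, hd, hyd⟩
    · rfl
    · exact absurd (hxy.symm.trans hfu) (hne ⟨d, hd⟩ y hyd)
    · exact absurd (hxy.trans hfu) (hne ⟨c, hc⟩ x hxc)
    · have h1 := hmaps ⟨c, hc⟩ x hxc
      have h2 := hmaps ⟨d, hd⟩ y hyd
      rw [← hxy] at h2
      have h3 : c = d := Subtype.ext_iff.1 (σ.injective (Subtype.ext
        (branch_unique hG (σ ⟨c, hc⟩).2.1 (σ ⟨d, hd⟩).2.1 h1 h2)))
      subst h3
      rw [hfc ⟨c, hc⟩ x hxc, hfc ⟨c, hc⟩ y hyd] at hxy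
      exact (hF ⟨c, hc⟩).injOn hxc hyd hxy
  · intro y hy
    rcases exists_mem_branch hG y hy with rfl | ⟨c', hc', hyc⟩
    · exact ⟨u, root_mem_branch G _ _, hfu⟩
    · obtain ⟨c, hc⟩ := σ.surjective ⟨c', hc'⟩
      have hyc' : y ∈ branch G (σ c).1 u' := by rw [hc]; exact hyc
      obtain ⟨x, hx, hxy⟩ := (hF c).surjOn hyc'
      exact ⟨x, branch_subset hG c.2.1 c.2.2 hx, (hfc c x hx).trans hxy⟩
  · intro x hx y hy
    rcases exists_mem_branch hG x hx with rfl | ⟨c, hc, hxc⟩ <;>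
      rcases exists_mem_branch hG y hy with rfl | ⟨d, hd, hyd⟩
    · simp
    · rw [hfu, G.adj_comm, hrootadj ⟨d, hd⟩ y hyd, G.adj_comm]
    · rw [hfu, hrootadj ⟨c, hc⟩ x hxc]
    · by_cases hcd : c = d
      · subst hcd
        rw [hfc ⟨c, hc⟩ x hxc, hfc ⟨c, hc⟩ y hyd]
        exact hadj ⟨c, hc⟩ x hxc y hyd
      · have hcd' : (σ ⟨c, hc⟩).1 ≠ (σ ⟨d, hd⟩).1 := fun h =>
          hcd (Subtype.ext_iff.1 (σ.injective (Subtype.ext h)))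
        refine iff_of_false (fun hxy => ?_) fun hxy => ?_
        · have h1 := (eq_of_adj_of_mem_branch hG hc.1.symm hxc
            (fun hyc => hcd (branch_unique hG hc.1 hd.1 hyc hyd)) hxy).2
          exact not_mem_branch hG hd.1.symm (h1 ▸ hyd)
        · have h1 := (eq_of_adj_of_mem_branch hG (σ ⟨c, hc⟩).2.1.symm (hmaps ⟨c, hc⟩ x hxc)
            (fun hyc => hcd' (branch_unique hG (σ ⟨c, hc⟩).2.1 (σ ⟨d, hd⟩).2.1 hyc
              (hmaps ⟨d, hd⟩ y hyd))) hxy).2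
          exact hne ⟨d, hd⟩ y hyd h1

theorem symmetricAbout_of_bijOn_branch (hG : G.IsTree) (h : G.Adj u v) {f : V → V}
    (hf : Set.BijOn f (branch G u v) (branch G v u)) (hroot : f u = v)
    (hadj : ∀ x ∈ branch G u v, ∀ y ∈ branch G u v, G.Adj x y ↔ G.Adj (f x) (f y)) :
    SymmetricAbout G u v := by
  have hsupp : ((G.deleteEdges {s(u, v)}).connectedComponentMk u).supp = branch G u v := by
    ext x
    simp [branch, SimpleGraph.reachable_comm]
  have hsupp' : ((G.deleteEdges {s(u, v)}).connectedComponentMk v).supp = branch G v u := by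
    ext x
    simp [branch, SimpleGraph.reachable_comm, Sym2.eq_swap (a := v)]
  refine ⟨h, SimpleGraph.connectedComponentMk _ u, SimpleGraph.connectedComponentMk _ v,
    SimpleGraph.ConnectedComponent.connectedComponentMk_mem,
    SimpleGraph.ConnectedComponent.connectedComponentMk_mem, ?_, ?_, ?_⟩
  · intro heq
    exact not_mem_branch hG.isAcyclic h (SimpleGraph.ConnectedComponent.eq.1 heq)
  · intro c
    induction c using SimpleGraph.ConnectedComponent.ind with
    | h x =>
      rcases mem_branch_or_mem_branch (u := u) (v := v) hG.1 x with hx | hx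
      · rw [← hsupp] at hx
        exact Or.inl hx
      · rw [← hsupp'] at hx
        exact Or.inr hx
  -- The deleted edge has only one end in each branch, so deleting it does not change adjacency
  -- inside a branch.
  · have hdel : ∀ x ∈ branch G u v, ∀ y ∈ branch G u v,
        ((G.deleteEdges {s(u, v)}).Adj x y ↔ G.Adj x y) := by
      intro x hx y hy
      rw [SimpleGraph.deleteEdges_adj]
      refine and_iff_left fun hs => ?_
      rcases Sym2.eq_iff.1 (Set.mem_singleton_iff.1 hs) with ⟨-, rfl⟩ | ⟨rfl, -⟩
      · exact not_mem_branch hG.isAcyclic h hy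
      · exact not_mem_branch hG.isAcyclic h hx
    have hdel' : ∀ x ∈ branch G v u, ∀ y ∈ branch G v u,
        ((G.deleteEdges {s(u, v)}).Adj x y ↔ G.Adj x y) := by
      intro x hx y hy
      rw [SimpleGraph.deleteEdges_adj]
      refine and_iff_left fun hs => ?_
      rcases Sym2.eq_iff.1 (Set.mem_singleton_iff.1 hs) with ⟨rfl, -⟩ | ⟨-, rfl⟩
      · exact not_mem_branch hG.isAcyclic h.symm hx
      · exact not_mem_branch hG.isAcyclic h.symm hy
    rw [← hsupp, ← hsupp'] at hf
    refine ⟨⟨hf.equiv f, ?_⟩, Subtype.ext hroot⟩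
    rintro ⟨x, hx⟩ ⟨y, hy⟩
    have hx' : x ∈ branch G u v := hsupp ▸ hx
    have hy' : y ∈ branch G u v := hsupp ▸ hy
    have hfx : f x ∈ branch G v u := hsupp' ▸ hf.mapsTo hx
    have hfy : f y ∈ branch G v u := hsupp' ▸ hf.mapsTo hy
    change (G.deleteEdges {s(u, v)}).Adj (f x) (f y) ↔ (G.deleteEdges {s(u, v)}).Adj x y
    rw [hdel x hx' y hy', hdel' _ hfx _ hfy, hadj x hx' y hy']

end Branches

/-! ### Matula numbers of branches and their ranks. -/

section Codes

/-- Two families of natural numbers agree up to a bijection of their index types if the products of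
the primes that they enumerate are equal. -/
theorem exists_equiv_of_prod_nth_prime_eq {α β : Type*} [Fintype α] [Fintype β] (f : α → ℕ)
    (g : β → ℕ)
    (h : ∏ a, Nat.nth Nat.Prime (f a) = ∏ b, Nat.nth Nat.Prime (g b)) :
    ∃ σ : α ≃ β, ∀ a, g (σ a) = f a := by
  classical
  have hprime : ∀ s : Multiset ℕ, ∀ p ∈ s.map (Nat.nth Nat.Prime), Prime p := by
    intro s p hp
    obtain ⟨k, -, rfl⟩ := Multiset.mem_map.1 hp
    exact (Nat.prime_nth_prime k).prime
  have hprod : ((Finset.univ.val.map f).map (Nat.nth Nat.Prime)).prod =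
      ((Finset.univ.val.map g).map (Nat.nth Nat.Prime)).prod := by
    rw [Multiset.map_map, Multiset.map_map]
    exact h
  have h1 := UniqueFactorizationMonoid.normalizedFactors_prod_of_prime
    (hprime (Finset.univ.val.map f))
  rw [hprod, UniqueFactorizationMonoid.normalizedFactors_prod_of_prime (hprime _)] at h1
  -- Unique factorization recovers the multiset of primes, hence that of their indices; equal
  -- multiplicities then match the fibers.
  have h2 : Finset.univ.val.map g = Finset.univ.val.map f :=
    Multiset.map_injective (Nat.nth_injective Nat.infinite_setOfPred_prime) h1
  have h3 : ∀ c, Nonempty ({a // f a = c} ≃ {b // g b = c}) := by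
    intro c
    have h4 := congrArg (Multiset.count c) h2
    rw [Multiset.count_map, Multiset.count_map, ← Finset.filter_val, ← Finset.filter_val,
      Finset.card_val, Finset.card_val] at h4
    refine ⟨Fintype.equivOfCardEq ?_⟩
    rw [Fintype.card_subtype, Fintype.card_subtype]
    simpa [eq_comm] using h4.symm
  exact ⟨Equiv.ofFiberEquiv fun c => (h3 c).some, fun a => Equiv.ofFiberEquiv_map _ a⟩

variable {V W : Type*} [Fintype V] [Fintype W] {G : SimpleGraph V} {K : SimpleGraph W}
  {u v w u' v' : V}

open Classical in
/-- The Matula number of the tree rooted at `u` that is formed by the walks from `u` of length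
less than `k` that do not start towards `v` and do not backtrack. -/
noncomputable def matula (G : SimpleGraph V) : ℕ → V → V → ℕ
  | 0, _, _ => 1
  | k + 1, u, v => ∏ c : {c // G.Adj u c ∧ c ≠ v}, Nat.nth Nat.Prime (matula G k c u)

/-- The Matula number of the branch at `u` away from its neighbor `v`, in a tree. -/
noncomputable def branchCode (G : SimpleGraph V) (u v : V) : ℕ :=
  matula G (Fintype.card V) u v

theorem matula_iso (φ : G ≃g K) (k : ℕ) (u v : V) :
    matula K k (φ u) (φ v) = matula G k u v := by
  classical
  induction k generalizing u v with
  | zero => rfl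
  | succ k ih =>
    symm
    refine Fintype.prod_equiv (φ.toEquiv.subtypeEquiv fun c =>
      (and_congr φ.map_adj_iff (not_congr φ.injective.eq_iff)).symm) _ _ fun c => ?_
    rw [← ih]
    rfl

theorem branchCode_iso (φ : G ≃g K) (u v : V) :
    branchCode K (φ u) (φ v) = branchCode G u v := by
  rw [branchCode, branchCode, ← Fintype.card_congr φ.toEquiv, matula_iso]

/-- Child branches are strictly smaller, so a depth of at least the size of the branch already
explores all of it. Thus the cutoff `Fintype.card V` is harmless and the code satisfies an exact
recursion. -/
theorem matula_succ_eq (hG : G.IsAcyclic) (k : ℕ) (h : G.Adj u v)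
    (hk : (branch G u v).ncard ≤ k) : matula G (k + 1) u v = matula G k u v := by
  classical
  induction k generalizing u v with
  | zero =>
    have h1 := (Set.ncard_pos (Set.toFinite _)).2 ⟨u, root_mem_branch G u v⟩
    omega
  | succ k ih =>
    rw [matula, matula]
    refine Finset.prod_congr rfl fun c _ => ?_
    rw [ih c.2.1.symm]
    have h1 := Set.ncard_lt_ncard (branch_ssubset hG c.2.1 c.2.2) (Set.toFinite _)
    omega

open Classical in
theorem branchCode_eq_prod (hG : G.IsAcyclic) (h : G.Adj u v) :
    branchCode G u v =
      ∏ c : {c // G.Adj u c ∧ c ≠ v}, Nat.nth Nat.Prime (branchCode G c u) := by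
  have h1 := Set.ncard_le_card (branch G u v)
  rw [Nat.card_eq_fintype_card] at h1
  rw [branchCode, ← matula_succ_eq hG _ h h1]
  rfl

theorem branchCode_eq_prod_erase {ι : Type*} [Fintype ι] [DecidableEq ι] (hG : G.IsAcyclic)
    (σ : ι ≃ G.neighborSet u) {p : ι} (hp : (σ p : V) = v) :
    branchCode G u v =
      ∏ q ∈ Finset.univ.erase p, Nat.nth Nat.Prime (branchCode G (σ q) u) := by
  classical
  rw [branchCode_eq_prod hG (hp ▸ (σ p).2)]
  symm
  refine Finset.prod_bij (fun q hq => ⟨σ q, (σ q).2, fun h => ?_⟩) (fun _ _ => Finset.mem_univ _)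
    ?_ ?_ fun _ _ => rfl
  · exact Finset.ne_of_mem_erase hq (σ.injective (Subtype.ext (h.trans hp.symm)))
  · intro q _ q' _ h
    exact σ.injective (Subtype.ext (congrArg (fun c => c.1) h))
  · rintro ⟨c, hc, hcv⟩ _
    refine ⟨σ.symm ⟨c, hc⟩, Finset.mem_erase.2 ⟨?_, Finset.mem_univ _⟩, ?_⟩
    · rintro rfl
      simp at hp
      exact hcv hp
    · simp

/-- The code of `v` has the factor `Nat.nth Nat.Prime k`, with `k` the code of `u`, and this prime
is at least `k + 2`. -/
theorem branchCode_lt (hG : G.IsAcyclic) (huv : G.Adj u v) (hvw : G.Adj v w) (huw : u ≠ w) :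
    branchCode G u v < branchCode G v w := by
  classical
  rw [branchCode_eq_prod hG hvw]
  refine lt_of_lt_of_le ?_ (Finset.single_le_prod'
    (f := fun c : {c // G.Adj v c ∧ c ≠ w} => Nat.nth Nat.Prime (branchCode G c v))
    (fun c _ => (Nat.prime_nth_prime _).one_lt.le)
    (Finset.mem_univ (⟨u, huv.symm, huw⟩ : {c // G.Adj v c ∧ c ≠ w})))
  have := Nat.add_two_le_nth_prime (branchCode G u v)
  dsimp only
  omega

/-- Both codes are products over the ports other than `p`, compared factor by factor. Indexing by
ports fits a node that compares its counts with a hypothetical position in the tree. -/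
theorem branchCode_le_of_forall_le {ι : Type*} (hG : G.IsAcyclic)
    (σ : ι ≃ G.neighborSet u) (σ' : ι ≃ G.neighborSet u') (p : ι)
    (hle : ∀ q ≠ p, branchCode G (σ q) u ≤ branchCode G (σ' q) u') :
    branchCode G u (σ p) ≤ branchCode G u' (σ' p) := by
  classical
  have := Fintype.ofEquiv _ σ.symm
  rw [branchCode_eq_prod_erase hG σ rfl, branchCode_eq_prod_erase hG σ' rfl]
  refine Finset.prod_le_prod' fun q hq => ?_
  exact (Nat.nth_le_nth Nat.infinite_setOfPred_prime).2 (hle q (Finset.ne_of_mem_erase hq))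

/-- Strictness of the product: one strictly smaller factor would make the whole code strictly
smaller. Quiescence depends on this. -/
theorem branchCode_eq_of_forall_le {ι : Type*} (hG : G.IsAcyclic)
    (σ : ι ≃ G.neighborSet u) (σ' : ι ≃ G.neighborSet u') (p : ι)
    (hle : ∀ q ≠ p, branchCode G (σ q) u ≤ branchCode G (σ' q) u')
    (heq : branchCode G u (σ p) = branchCode G u' (σ' p)) (q : ι) (hq : q ≠ p) :
    branchCode G (σ q) u = branchCode G (σ' q) u' := by
  classical
  have := Fintype.ofEquiv _ σ.symm
  by_contra hne
  rw [branchCode_eq_prod_erase hG σ rfl, branchCode_eq_prod_erase hG σ' rfl] at heq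
  refine heq.not_lt (Finset.prod_lt_prod (fun r _ => (Nat.prime_nth_prime _).pos)
    (fun r hr => (Nat.nth_le_nth Nat.infinite_setOfPred_prime).2 (hle r (Finset.ne_of_mem_erase hr)))
    ⟨q, Finset.mem_erase.2 ⟨hq, Finset.mem_univ _⟩, ?_⟩)
  exact (Nat.nth_lt_nth Nat.infinite_setOfPred_prime).2 (lt_of_le_of_ne (hle q hq) hne)

theorem exists_bijOn_branch (hG : G.IsAcyclic) (h : G.Adj u v) (h' : G.Adj u' v')
    (heq : branchCode G u v = branchCode G u' v') :
    ∃ f : V → V, Set.BijOn f (branch G u v) (branch G u' v') ∧ f u = u' ∧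
      ∀ x ∈ branch G u v, ∀ y ∈ branch G u v, G.Adj x y ↔ G.Adj (f x) (f y) := by
  classical
  induction hk : (branch G u v).ncard using Nat.strong_induction_on generalizing u v u' v' with
  | _ k ih =>
    subst hk
    rw [branchCode_eq_prod hG h, branchCode_eq_prod hG h'] at heq
    obtain ⟨σ, hσ⟩ := exists_equiv_of_prod_nth_prime_eq _ _ heq
    refine exists_bijOn_branch_of_children hG h h' σ fun c => ?_
    exact ih _ (Set.ncard_lt_ncard (branch_ssubset hG c.2.1 c.2.2) (Set.toFinite _)) c.2.1.symm
      (σ c).2.1.symm (hσ c).symm rfl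

/-- Equal codes at the two ends of an edge would give an isomorphism of the two sides. This is where
asymmetry enters. -/
theorem branchCode_ne_swap (hG : G.IsTree) (hsym : ∀ u v, ¬ SymmetricAbout G u v)
    (h : G.Adj u v) : branchCode G u v ≠ branchCode G v u := by
  intro heq
  obtain ⟨f, hf, hroot, hadj⟩ := exists_bijOn_branch hG.isAcyclic h h.symm heq
  exact hsym u v (symmetricAbout_of_bijOn_branch hG h hf hroot hadj)

open Classical in
/-- The rank of the code of the branch at `u` away from `v`, among the codes of all branches. -/
noncomputable def branchRank (G : SimpleGraph V) (u v : V) : ℕ :=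
  (Finset.univ.filter fun e : G.Dart => branchCode G e.fst e.snd ≤ branchCode G u v).card

theorem branchRank_le_iff (h : G.Adj u v) :
    branchRank G u v ≤ branchRank G u' v' ↔ branchCode G u v ≤ branchCode G u' v' := by
  classical
  constructor
  · intro hle
    by_contra! hlt
    refine hle.not_gt (Finset.card_lt_card ⟨fun e he => ?_, fun hsub => ?_⟩)
    · rw [Finset.mem_filter] at he ⊢
      exact ⟨he.1, he.2.trans hlt.le⟩
    · have h1 := hsub (Finset.mem_filter.2 ⟨Finset.mem_univ (⟨(u, v), h⟩ : G.Dart), le_rfl⟩)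
      exact hlt.not_ge (Finset.mem_filter.1 h1).2
  · intro hle
    refine Finset.card_le_card fun e he => ?_
    rw [Finset.mem_filter] at he ⊢
    exact ⟨he.1, he.2.trans hle⟩

theorem branchRank_eq_iff (h : G.Adj u v) (h' : G.Adj u' v') :
    branchRank G u v = branchRank G u' v' ↔ branchCode G u v = branchCode G u' v' := by
  simp only [le_antisymm_iff, branchRank_le_iff h, branchRank_le_iff h']

theorem branchRank_lt_iff (h' : G.Adj u' v') :
    branchRank G u v < branchRank G u' v' ↔ branchCode G u v < branchCode G u' v' := by
  simp only [← not_le, branchRank_le_iff h']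

theorem branchRank_pos (h : G.Adj u v) : 0 < branchRank G u v := by
  classical
  exact Finset.card_pos.2 ⟨⟨(u, v), h⟩, Finset.mem_filter.2 ⟨Finset.mem_univ _, le_rfl⟩⟩

theorem card_dart_add_two (hG : G.IsTree) : Nat.card G.Dart + 2 = 2 * Fintype.card V := by
  classical
  have h1 := hG.card_edgeFinset
  have h2 := G.dart_card_eq_twice_card_edges
  rw [← h1, mul_add, ← h2, Nat.card_eq_fintype_card]

theorem branchRank_le (hG : G.IsTree) (u v : V) : branchRank G u v ≤ 2 * Fintype.card V := by
  classical
  have h1 := card_dart_add_two hG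
  have h2 : branchRank G u v ≤ Nat.card G.Dart :=
    Nat.card_eq_fintype_card (α := G.Dart) ▸ Finset.card_le_univ _
  omega

theorem branchRank_iso (φ : G ≃g K) (u v : V) :
    branchRank K (φ u) (φ v) = branchRank G u v := by
  classical
  symm
  refine Finset.card_bij (fun e _ => ⟨(φ e.fst, φ e.snd), φ.map_adj_iff.2 e.adj⟩) ?_ ?_ ?_
  · intro e he
    rw [Finset.mem_filter] at he ⊢
    simpa [branchCode_iso] using he.2
  · intro e _ e' _ h
    simpa [SimpleGraph.Dart.ext_iff, Prod.ext_iff] using h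
  · rintro ⟨⟨a, b⟩, hab⟩ he
    refine ⟨⟨(φ.symm a, φ.symm b), φ.symm.map_adj_iff.2 hab⟩, ?_, by simp⟩
    rw [Finset.mem_filter] at he ⊢
    rw [← branchCode_iso φ]
    simpa [branchCode_iso] using he.2

end Codes

/-! ### The orientation of the tree and its unique sink. -/

section Orientation

variable {V : Type*} [Fintype V] {G : SimpleGraph V} {u v w a : V}

/-- The neighbors `v` and `w` are such that the branch at `v` ranks lower than the branch at `w`:
the edge between them is oriented from `v` to `w`. -/
def Toward (G : SimpleGraph V) (v w : V) : Prop :=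
  G.Adj v w ∧ branchRank G v w < branchRank G w v

/-- No edge at `a` is oriented away from `a`. -/
def IsSink (G : SimpleGraph V) (a : V) : Prop :=
  ∀ b, ¬ Toward G a b

theorem Toward.not_swap (h : Toward G v w) : ¬ Toward G w v :=
  fun h' => lt_asymm h.2 h'.2

theorem branchRank_lt (hG : G.IsAcyclic) (huv : G.Adj u v) (hvw : G.Adj v w) (huw : u ≠ w) :
    branchRank G u v < branchRank G v w :=
  (branchRank_lt_iff hvw).2 (branchCode_lt hG huv hvw huw)

/-- Two outgoing edges would give a cyclic chain of strict inequalities between the four ranks on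
them, as ranks grow along non-backtracking paths. -/
theorem Toward.unique (hG : G.IsAcyclic) (hv : Toward G u v) (hw : Toward G u w) : v = w := by
  by_contra hne
  have h1 := branchRank_lt hG hv.1.symm hw.1 hne
  have h2 := branchRank_lt hG hw.1.symm hv.1 (Ne.symm hne)
  have h3 := hv.2
  have h4 := hw.2
  omega

theorem toward_or_toward (hG : G.IsTree) (hsym : ∀ u v, ¬ SymmetricAbout G u v)
    (h : G.Adj v w) : Toward G v w ∨ Toward G w v := by
  have h1 : branchRank G v w ≠ branchRank G w v := fun h1 =>
    branchCode_ne_swap hG hsym h ((branchRank_eq_iff h h.symm).1 h1)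
  exact (lt_or_gt_of_ne h1).imp (fun h2 => ⟨h, h2⟩) fun h2 => ⟨h.symm, h2⟩

theorem exists_isSink (hG : G.IsTree) : ∃ a, IsSink G a := by
  classical
  by_contra! hno
  simp only [IsSink, not_forall, not_not] at hno
  choose f hf using hno
  obtain ⟨v₀⟩ := hG.1.nonempty
  -- Without a sink, following outgoing edges would increase the rank forever.
  obtain ⟨v, -, hv⟩ := Finset.exists_max_image Finset.univ (fun v => branchRank G v (f v))
    ⟨v₀, Finset.mem_univ _⟩
  have h1 := branchRank_lt hG.isAcyclic (hf v).1 (hf (f v)).1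
    fun h => (hf v).not_swap (by simpa [← h] using hf (f v))
  exact (hv (f v) (Finset.mem_univ _)).not_gt h1

/-- Every node has a directed path to the sink: on a walk from `a`, a step along an outgoing edge
can only return to the parent, which is already connected. -/
theorem IsSink.induction (ha : IsSink G a) (hG : G.IsTree)
    (hsym : ∀ u v, ¬ SymmetricAbout G u v) {p : V → Prop} (sink : p a)
    (step : ∀ v w, Toward G v w → p w → p v) (v : V) : p v := by
  have hreach : Relation.ReflTransGen (fun w v => Toward G v w) a v := by
    have h := (SimpleGraph.reachable_iff_reflTransGen _ _).1 (hG.1.preconnected a v)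
    induction h with
    | refl => exact Relation.ReflTransGen.refl
    | @tail y z _ hyz ih =>
      rcases toward_or_toward hG hsym hyz with h | h
      · rcases Relation.ReflTransGen.cases_tail ih with rfl | ⟨w, hw, hwy⟩
        · exact absurd h (ha z)
        · exact h.unique hG.isAcyclic hwy ▸ hw
      · exact ih.tail h
  induction hreach with
  | refl => exact sink
  | tail _ h ih => exact step _ _ h ih

theorem IsSink.eq_or_exists_toward (ha : IsSink G a) (hG : G.IsTree)
    (hsym : ∀ u v, ¬ SymmetricAbout G u v) (v : V) : v = a ∨ ∃ w, Toward G v w :=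
  ha.induction hG hsym (p := fun v => v = a ∨ ∃ w, Toward G v w) (Or.inl rfl)
    (fun _ w h _ => Or.inr ⟨w, h⟩) v

theorem IsSink.unique (ha : IsSink G a) (hG : G.IsTree)
    (hsym : ∀ u v, ¬ SymmetricAbout G u v) (hv : IsSink G v) : v = a :=
  (ha.eq_or_exists_toward hG hsym v).resolve_right fun ⟨w, hw⟩ => hv w hw

/-- Every branch away from the parent is dominated by a branch at a neighbor of the sink. -/
theorem IsSink.exists_branchRank_le (ha : IsSink G a) (hG : G.IsTree)
    (hsym : ∀ u v, ¬ SymmetricAbout G u v) (v : V) :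
    ∀ w, Toward G v w → ∃ z, G.Adj z a ∧ branchRank G v w ≤ branchRank G z a := by
  refine ha.induction hG hsym (p := fun v => ∀ w, Toward G v w → ∃ z, G.Adj z a ∧
    branchRank G v w ≤ branchRank G z a) (fun w h => absurd h (ha w)) ?_ v
  intro v w h ih w' hw'
  obtain rfl := h.unique hG.isAcyclic hw'
  rcases ha.eq_or_exists_toward hG hsym w with rfl | ⟨y, hy⟩
  · exact ⟨v, h.1, le_rfl⟩
  · obtain ⟨z, hz, hle⟩ := ih y hy
    refine ⟨z, hz, le_trans (branchRank_lt hG.isAcyclic h.1 hy.1 ?_).le hle⟩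
    rintro rfl
    exact h.not_swap hy

end Orientation

/-! ### The algorithm and the local properties of its sending rule. -/

section Flow

variable {V W : Type*} [Fintype V] [Fintype W] {G : SimpleGraph V} {K : SimpleGraph W}
  {d : ℕ} {x y : Fin d → ℕ} {p : Fin d} {v : V}

open Classical in
/-- The greatest rank of a branch that a node which has received `x q` pulses at each of its ports
`q` may attribute to itself in the direction of its port `p`. -/
noncomputable def flow (G : SimpleGraph V) (x : Fin d → ℕ) (p : Fin d) : ℕ :=
  (Finset.univ.filter fun e : V × V => ∃ σ : Fin d ≃ G.neighborSet e.1, (σ p : V) = e.2 ∧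
    ∀ q ≠ p, branchRank G (σ q) e.1 ≤ x q).sup fun e => branchRank G e.1 e.2

/-- The numbers of received pulses are exactly those that identify the sink. -/
def Detects (G : SimpleGraph V) (x : Fin d → ℕ) : Prop :=
  ∃ a, IsSink G a ∧ ∃ σ : Fin d ≃ G.neighborSet a, ∀ q, x q = branchRank G (σ q) a

open Classical in
/-- The total number of pulses that a node sends through its port `p` in reaction to the pulses
that it has received; `2 * Fintype.card V + 1` pulses tell that a leader has been elected. -/
noncomputable def target (G : SimpleGraph V) (x : Fin d → ℕ) (p : Fin d) : ℕ :=
  if Detects G x ∨ ∃ q ≠ p, 2 * Fintype.card V < x q then 2 * Fintype.card V + 1 else flow G x p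

open Classical in
/-- Leader election in the tree `G`. -/
noncomputable def treeElection (G : SimpleGraph V) : Algorithm where
  send d h p := target G (fun q : Fin d => h.count q) p -
    if h = [] then 0 else target G (fun q : Fin d => h.dropLast.count q) p
  decision d h :=
    if Detects G (fun q : Fin d => h.count q) then some Output.leader
    else if ∃ q : Fin d, 2 * Fintype.card V < h.count q then some Output.nonLeader else none

theorem toward_iso (φ : G ≃g K) (v w : V) : Toward K (φ v) (φ w) ↔ Toward G v w := by
  simp only [Toward, branchRank_iso, φ.map_adj_iff]

theorem isSink_iso (φ : G ≃g K) (v : V) : IsSink K (φ v) ↔ IsSink G v := by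
  simp only [IsSink, ← toward_iso φ]
  exact ⟨fun h b => h (φ b), fun h b => by simpa using h (φ.symm b)⟩

theorem flow_le_flow_of_iso (φ : G ≃g K) (x : Fin d → ℕ) (p : Fin d) :
    flow G x p ≤ flow K x p := by
  classical
  refine Finset.sup_le fun e he => ?_
  obtain ⟨σ, hσ, hle⟩ := (Finset.mem_filter.1 he).2
  rw [← branchRank_iso φ]
  refine Finset.le_sup (f := fun e : W × W => branchRank K e.1 e.2) (b := (φ e.1, φ e.2))
    (Finset.mem_filter.2 ⟨Finset.mem_univ _, σ.trans (φ.mapNeighborSet e.1), ?_, ?_⟩)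
  · simp [← hσ]
  · intro q hq
    simpa [branchRank_iso] using hle q hq

theorem flow_iso (φ : G ≃g K) (x : Fin d → ℕ) (p : Fin d) : flow K x p = flow G x p :=
  le_antisymm (flow_le_flow_of_iso φ.symm x p) (flow_le_flow_of_iso φ x p)

theorem Detects.of_iso (φ : G ≃g K) (h : Detects G x) : Detects K x := by
  obtain ⟨a, ha, σ, hσ⟩ := h
  refine ⟨φ a, (isSink_iso φ a).2 ha, σ.trans (φ.mapNeighborSet a), fun q => ?_⟩
  simpa [branchRank_iso] using hσ q

theorem detects_iso (φ : G ≃g K) : Detects K x ↔ Detects G x :=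
  ⟨fun h => h.of_iso φ.symm, fun h => h.of_iso φ⟩

theorem target_iso (φ : G ≃g K) (x : Fin d → ℕ) (p : Fin d) : target K x p = target G x p := by
  unfold target
  rw [flow_iso φ, ← Fintype.card_congr φ.toEquiv]
  classical exact if_congr (or_congr_left (detects_iso φ)) rfl rfl

/-- The rule is invariant under relabeling, so the analysis may take the network itself as the
advice. -/
theorem treeElection_iso (φ : G ≃g K) : treeElection K = treeElection G := by
  unfold treeElection
  simp only [target_iso φ, ← Fintype.card_congr φ.toEquiv]
  congr 1
  funext d h
  classical exact if_congr (detects_iso φ) rfl rfl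

theorem flow_le_two_mul_card (hG : G.IsTree) : flow G x p ≤ 2 * Fintype.card V :=
  Finset.sup_le fun _ _ => branchRank_le hG _ _

theorem flow_mono (h : x ≤ y) : flow G x p ≤ flow G y p := by
  classical
  refine Finset.sup_mono fun e he => ?_
  obtain ⟨-, σ, hσ, hle⟩ := Finset.mem_filter.1 he
  exact Finset.mem_filter.2 ⟨Finset.mem_univ _, σ, hσ, fun q hq => (hle q hq).trans (h q)⟩

theorem target_le (hG : G.IsTree) : target G x p ≤ 2 * Fintype.card V + 1 := by
  unfold target
  split_ifs
  · exact le_rfl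
  · exact (flow_le_two_mul_card hG).trans (Nat.le_succ _)

/-- Detection requires exact counts and could be lost when they grow, hence the hypothesis on `x`; a
node that detects halts anyway. -/
theorem target_mono (hG : G.IsTree) (hx : ¬ Detects G x) (h : x ≤ y) :
    target G x p ≤ target G y p := by
  by_cases hc : Detects G y ∨ ∃ q ≠ p, 2 * Fintype.card V < y q
  · rw [target.eq_def G y, if_pos hc]
    exact target_le hG
  · rw [target.eq_def G y, if_neg hc, target, if_neg]
    · exact flow_mono h
    · rintro (h1 | ⟨q, hq, h1⟩)
      · exact hx h1
      · exact hc (Or.inr ⟨q, hq, h1.trans_le (h q)⟩)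

theorem target_eq_flow (hx : ¬ Detects G x) (h : ∀ q ≠ p, x q ≤ 2 * Fintype.card V) :
    target G x p = flow G x p := by
  rw [target, if_neg]
  rintro (h1 | ⟨q, hq, h1⟩)
  · exact hx h1
  · exact (h q hq).not_gt h1

theorem flow_le (hG : G.IsTree) (τ : Fin d ≃ G.neighborSet v)
    (h : ∀ q ≠ p, x q ≤ branchRank G (τ q) v) : flow G x p ≤ branchRank G v (τ p) := by
  classical
  refine Finset.sup_le fun e he => ?_
  obtain ⟨-, σ, hσ, hle⟩ := Finset.mem_filter.1 he
  rw [← hσ, branchRank_le_iff (σ p).2]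
  refine branchCode_le_of_forall_le hG.isAcyclic σ τ p fun q hq => ?_
  rw [← branchRank_le_iff (G.adj_symm (σ q).2)]
  exact (hle q hq).trans (h q hq)

theorem le_flow (τ : Fin d ≃ G.neighborSet v) (h : ∀ q ≠ p, branchRank G (τ q) v ≤ x q) :
    branchRank G v (τ p) ≤ flow G x p := by
  classical
  exact Finset.le_sup (f := fun e : V × V => branchRank G e.1 e.2) (b := (v, (τ p : V)))
    (Finset.mem_filter.2 ⟨Finset.mem_univ _, τ, rfl, h⟩)

/-- A node whose counts do not exceed the true ranks can send its full rank only after receiving all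
of them. -/
theorem eq_of_flow_eq (hG : G.IsTree) (τ : Fin d ≃ G.neighborSet v)
    (h : ∀ q ≠ p, x q ≤ branchRank G (τ q) v) (hflow : branchRank G v (τ p) ≤ flow G x p)
    (q : Fin d) (hq : q ≠ p) : x q = branchRank G (τ q) v := by
  classical
  -- Ranks are positive, so the supremum is not the value `0` of an empty set and some candidate
  -- position reaches the bound.
  obtain ⟨e, he, heq⟩ := (Finset.le_sup_iff (bot_lt_iff_ne_bot.2
    (branchRank_pos (τ p).2).ne')).1 hflow
  obtain ⟨-, σ, hσ, hle⟩ := Finset.mem_filter.1 he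
  rw [← hσ, branchRank_le_iff (τ p).2] at heq
  have h1 : ∀ q ≠ p, branchCode G (σ q) e.1 ≤ branchCode G (τ q) v := fun q hq =>
    (branchRank_le_iff (G.adj_symm (σ q).2)).1 ((hle q hq).trans (h q hq))
  have h2 := branchCode_eq_of_forall_le hG.isAcyclic σ τ p h1
    (le_antisymm (branchCode_le_of_forall_le hG.isAcyclic σ τ p h1) heq) q hq
  rw [← branchRank_eq_iff (G.adj_symm (σ q).2) (G.adj_symm (τ q).2)] at h2
  exact le_antisymm (h q hq) (h2 ▸ hle q hq)

theorem Detects.eq_of_le (hG : G.IsTree) (hsym : ∀ u v, ¬ SymmetricAbout G u v)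
    (hv : IsSink G v) (τ : Fin d ≃ G.neighborSet v) (h : ∀ q, x q ≤ branchRank G (τ q) v)
    (hx : Detects G x) (q : Fin d) : x q = branchRank G (τ q) v := by
  obtain ⟨a, ha, σ, hσ⟩ := hx
  obtain rfl := ha.unique hG hsym hv
  -- The assignment `σ` may permute the neighbors, but the sums agree, and a pointwise inequality
  -- with equal sums is an equality.
  have hsum : ∑ q, x q = ∑ q, branchRank G (τ q) v := by
    simp only [hσ]
    refine Fintype.sum_equiv (σ.trans τ.symm) _ _ fun q => ?_
    simp
  exact (Finset.sum_eq_sum_iff_of_le fun q _ => h q).1 hsum q (Finset.mem_univ _)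

/-- A node that is not the sink does not take itself for the sink, whatever it has received from
its parent. -/
theorem not_detects (hG : G.IsTree) (hsym : ∀ u v, ¬ SymmetricAbout G u v)
    (τ : Fin d ≃ G.neighborSet v) (hp : Toward G v (τ p))
    (h : ∀ q ≠ p, x q ≤ branchRank G (τ q) v) : ¬ Detects G x := by
  rintro ⟨a, ha, σ, hσ⟩
  have h1 : branchRank G a (σ p) ≤ branchRank G v (τ p) := by
    rw [branchRank_le_iff (σ p).2]
    refine branchCode_le_of_forall_le hG.isAcyclic σ τ p fun q hq => ?_
    rw [← branchRank_le_iff (G.adj_symm (σ q).2), ← hσ]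
    exact h q hq
  -- The branch at `a` away from port `p` would rank no higher than the branch at `z`. Behind port
  -- `p`, this contradicts the orientation of the edge from `z` to `a`; elsewhere, `z` is a child
  -- inside the former branch and ranks strictly lower.
  obtain ⟨z, hz, hle⟩ := ha.exists_branchRank_le hG hsym v _ hp
  by_cases hzp : z = σ p
  · rcases toward_or_toward hG hsym hz with h2 | h2
    · have h3 := h2.2
      rw [hzp] at h3 hle
      omega
    · exact ha _ h2
  · have h2 := branchRank_lt hG.isAcyclic hz (σ p).2 hzp
    omega

end Flow

/-! ### Global invariants of the received counts. -/

section Network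

variable {V : Type*} {G : SimpleGraph V} {P : PortNumbering G}
  {x : (v : V) → Fin (P.deg v) → ℕ} {v w : V} {p : Fin (P.deg v)} {q : Fin (P.deg w)}

/-- `p` and `q` are the ports at the two ends `v` and `w` of an edge. -/
def IsLink (P : PortNumbering G) {v w : V} (p : Fin (P.deg v)) (q : Fin (P.deg w)) : Prop :=
  (P.nbr v p : V) = w ∧ (P.nbr w q : V) = v

theorem IsLink.symm (h : IsLink P p q) : IsLink P q p :=
  ⟨h.2, h.1⟩

theorem exists_isLink_of_adj (h : G.Adj v w) :
    ∃ (p : Fin (P.deg v)) (q : Fin (P.deg w)), IsLink P p q :=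
  ⟨(P.nbr v).symm ⟨w, h⟩, (P.nbr w).symm ⟨v, h.symm⟩, by simp [IsLink]⟩

theorem exists_isLink (p : Fin (P.deg v)) : ∃ (w : V) (q : Fin (P.deg w)), IsLink P p q :=
  ⟨P.nbr v p, (P.nbr _).symm ⟨v, (P.nbr v p).2.symm⟩, by simp [IsLink]⟩

variable [Fintype V]

theorem toward_of_ne (hG : G.IsTree) (hsym : ∀ u v, ¬ SymmetricAbout G u v)
    (hp : Toward G v (P.nbr v p)) {r : Fin (P.deg v)} (hr : r ≠ p) :
    Toward G (P.nbr v r) v := by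
  refine (toward_or_toward hG hsym (P.nbr v r).2).resolve_left fun h => hr ?_
  exact (P.nbr v).injective (Subtype.ext (h.unique hG.isAcyclic hp))

/-- The nodes have received at most the pulses that the others send according to `target`. -/
def Consistent (P : PortNumbering G) (x : (v : V) → Fin (P.deg v) → ℕ) : Prop :=
  ∀ ⦃v w : V⦄ ⦃p : Fin (P.deg v)⦄ ⦃q : Fin (P.deg w)⦄, IsLink P p q → x v p ≤ target G (x w) q

theorem target_eq_flow_of_toward (hG : G.IsTree) (hsym : ∀ u v, ¬ SymmetricAbout G u v)
    (hp : Toward G v (P.nbr v p)) (h : ∀ r ≠ p, x v r ≤ branchRank G (P.nbr v r) v) :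
    target G (x v) p = flow G (x v) p :=
  target_eq_flow (not_detects hG hsym (P.nbr v) hp h)
    fun r hr => (h r hr).trans (branchRank_le hG _ _)

/-- Induction on the rank: the sender's children rank lower, so its counts from them are bounded,
and monotonicity bounds its flow. Pulses from its parent do not influence what it sends there. -/
theorem Consistent.le_branchRank (hx : Consistent P x) (hG : G.IsTree)
    (hsym : ∀ u v, ¬ SymmetricAbout G u v) (hp : Toward G (P.nbr v p) v) :
    x v p ≤ branchRank G (P.nbr v p) v := by
  induction hk : branchRank G (P.nbr v p) v using Nat.strong_induction_on generalizing v p with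
  | _ k ih =>
    subst hk
    obtain ⟨w, q, hpq⟩ := exists_isLink p
    rw [hpq.1] at hp ⊢
    have hq : Toward G w (P.nbr w q) := hpq.2.symm ▸ hp
    have h1 : ∀ r ≠ q, x w r ≤ branchRank G (P.nbr w r) w := by
      intro r hr
      have hr' := toward_of_ne hG hsym hq hr
      refine ih _ ?_ hr' rfl
      rw [hpq.1]
      refine branchRank_lt hG.isAcyclic hr'.1 hp.1 fun h => hr ?_
      exact (P.nbr w).injective (Subtype.ext (h.trans hpq.2.symm))
    refine (hx hpq).trans ?_
    rw [target_eq_flow_of_toward hG hsym hq h1]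
    simpa [hpq.2] using flow_le hG (P.nbr w) h1

theorem Consistent.le_branchRank_of_ne (hx : Consistent P x) (hG : G.IsTree)
    (hsym : ∀ u v, ¬ SymmetricAbout G u v) (hp : Toward G v (P.nbr v p)) :
    ∀ r ≠ p, x v r ≤ branchRank G (P.nbr v r) v :=
  fun _ hr => hx.le_branchRank hG hsym (toward_of_ne hG hsym hp hr)

theorem Consistent.target_le_branchRank (hx : Consistent P x) (hG : G.IsTree)
    (hsym : ∀ u v, ¬ SymmetricAbout G u v) (hp : Toward G v (P.nbr v p)) :
    target G (x v) p ≤ branchRank G v (P.nbr v p) := by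
  have h := hx.le_branchRank_of_ne hG hsym hp
  rw [target_eq_flow_of_toward hG hsym hp h]
  exact flow_le hG (P.nbr v) h

/-- The node has decided. -/
def Decided (G : SimpleGraph V) {d : ℕ} (x : Fin d → ℕ) : Prop :=
  Detects G x ∨ ∃ q, 2 * Fintype.card V < x q

theorem Decided.of_lt_target (hG : G.IsTree) {d : ℕ} {y : Fin d → ℕ} {r : Fin d}
    (h : 2 * Fintype.card V < target G y r) : Decided G y := by
  unfold target at h
  split_ifs at h with hc
  · exact hc.imp id fun ⟨q, hq⟩ => ⟨q, hq.2⟩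
  · exact absurd (flow_le_two_mul_card hG) h.not_ge

theorem Consistent.lt_of_decided (hx : Consistent P x) (hG : G.IsTree)
    (hsym : ∀ u v, ¬ SymmetricAbout G u v) (hp : Toward G v (P.nbr v p))
    (hv : Decided G (x v)) : 2 * Fintype.card V < x v p := by
  have h := hx.le_branchRank_of_ne hG hsym hp
  obtain ⟨r, hr⟩ := hv.resolve_left (not_detects hG hsym (P.nbr v) hp h)
  by_cases hrp : r = p
  · exact hrp ▸ hr
  · exact absurd ((h r hrp).trans (branchRank_le hG _ _)) hr.not_ge

/-- Induction away from the sink. A decided node was told so by its parent, which had then decided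
and thus received the node's full rank; by `eq_of_flow_eq`, the node had received full ranks from
its children. -/
theorem Consistent.eq_of_decided (hx : Consistent P x) (hG : G.IsTree)
    (hsym : ∀ u v, ¬ SymmetricAbout G u v) (hv : Decided G (x v))
    (hp : Toward G (P.nbr v p) v) : x v p = branchRank G (P.nbr v p) v := by
  obtain ⟨a, ha⟩ := exists_isSink hG
  refine ha.induction hG hsym (p := fun v => Decided G (x v) → ∀ p : Fin (P.deg v),
    Toward G (P.nbr v p) v → x v p = branchRank G (P.nbr v p) v) ?_ ?_ v hv p hp
  · intro hdec p _
    have hle : ∀ r, x a r ≤ branchRank G (P.nbr a r) a := fun r =>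
      hx.le_branchRank hG hsym
        ((toward_or_toward hG hsym (P.nbr a r).2).resolve_left (ha _))
    refine Detects.eq_of_le hG hsym ha (P.nbr a) hle (hdec.resolve_right ?_) p
    rintro ⟨r, hr⟩
    exact hr.not_ge ((hle r).trans (branchRank_le hG _ _))
  · intro v w hvw ih hdec p hp
    obtain ⟨r, q, hrq⟩ := exists_isLink_of_adj (P := P) hvw.1
    have hr : Toward G v (P.nbr v r) := hrq.1.symm ▸ hvw
    have h1 := (hx.lt_of_decided hG hsym hr hdec).trans_le (hx hrq)
    have h2 := ih (Decided.of_lt_target hG h1) q (hrq.2.symm ▸ hvw)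
    have h3 := hx.le_branchRank_of_ne hG hsym hr
    have h4 := hx hrq.symm
    rw [h2, target_eq_flow_of_toward hG hsym hr h3, hrq.2] at h4
    refine eq_of_flow_eq hG (P.nbr v) h3 (p := r) (by simpa [hrq.1] using h4) p ?_
    rintro rfl
    exact hr.not_swap hp

/-- No pulse is on its way to a node that has decided. -/
theorem Consistent.target_le_of_decided (hx : Consistent P x) (hG : G.IsTree)
    (hsym : ∀ u v, ¬ SymmetricAbout G u v) (hv : Decided G (x v)) (hpq : IsLink P p q) :
    target G (x w) q ≤ x v p := by
  rcases toward_or_toward hG hsym (P.nbr v p).2 with hp | hp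
  · exact (target_le hG).trans (hx.lt_of_decided hG hsym hp hv)
  · rw [hx.eq_of_decided hG hsym hv hp, hpq.1]
    rw [hpq.1] at hp
    simpa [hpq.2] using hx.target_le_branchRank hG hsym (p := q) (hpq.2.symm ▸ hp)

theorem eq_branchRank_of_forall_eq_target (hG : G.IsTree)
    (hsym : ∀ u v, ¬ SymmetricAbout G u v)
    (hx : ∀ ⦃v w : V⦄ ⦃p : Fin (P.deg v)⦄ ⦃q : Fin (P.deg w)⦄,
      IsLink P p q → x v p = target G (x w) q)
    (hp : Toward G (P.nbr v p) v) : x v p = branchRank G (P.nbr v p) v := by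
  have hcons : Consistent P x := fun _ _ _ _ h => (hx h).le
  induction hk : branchRank G (P.nbr v p) v using Nat.strong_induction_on generalizing v p with
  | _ k ih =>
    subst hk
    obtain ⟨w, q, hpq⟩ := exists_isLink p
    refine le_antisymm (hcons.le_branchRank hG hsym hp) ?_
    rw [hpq.1] at hp ⊢
    have hq : Toward G w (P.nbr w q) := hpq.2.symm ▸ hp
    rw [hx hpq, target_eq_flow_of_toward hG hsym hq (hcons.le_branchRank_of_ne hG hsym hq)]
    have h1 : ∀ r ≠ q, branchRank G (P.nbr w r) w ≤ x w r := by
      intro r hr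
      have hr' := toward_of_ne hG hsym hq hr
      refine (ih _ ?_ hr' rfl).ge
      rw [hpq.1]
      refine branchRank_lt hG.isAcyclic hr'.1 hp.1 fun h => hr ?_
      exact (P.nbr w).injective (Subtype.ext (h.trans hpq.2.symm))
    simpa [hpq.2] using le_flow (P.nbr w) h1

/-- When no pulse is left, the sink has detected that it is the sink, and all other nodes have been
told that there is a leader. -/
theorem exists_detects_of_forall_eq_target (hG : G.IsTree)
    (hsym : ∀ u v, ¬ SymmetricAbout G u v)
    (hx : ∀ ⦃v w : V⦄ ⦃p : Fin (P.deg v)⦄ ⦃q : Fin (P.deg w)⦄,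
      IsLink P p q → x v p = target G (x w) q) :
    ∃ a, Detects G (x a) ∧ ∀ v ≠ a, ¬ Detects G (x v) ∧ ∃ p, 2 * Fintype.card V < x v p := by
  have hcons : Consistent P x := fun _ _ _ _ h => (hx h).le
  obtain ⟨a, ha⟩ := exists_isSink hG
  have hdet : Detects G (x a) := ⟨a, ha, P.nbr a, fun r =>
    eq_branchRank_of_forall_eq_target hG hsym hx
      ((toward_or_toward hG hsym (P.nbr a r).2).resolve_left (ha _))⟩
  have hdec : ∀ v, Decided G (x v) := by
    refine ha.induction hG hsym (p := fun v => Decided G (x v)) (Or.inl hdet) ?_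
    intro v w hvw hw
    obtain ⟨p, q, hpq⟩ := exists_isLink_of_adj (P := P) hvw.1
    refine Or.inr ⟨p, ?_⟩
    rw [hx hpq, target, if_pos]
    · exact Nat.lt_succ_self _
    · refine hw.imp id fun ⟨r, hr⟩ => ⟨r, ?_, hr⟩
      -- The parent does not forward through the port that brought the announcement, but that port
      -- cannot lead to this child, whose pulses number at most a rank.
      rintro rfl
      rw [eq_branchRank_of_forall_eq_target hG hsym hx (hpq.2.symm ▸ hvw)] at hr
      exact hr.not_ge (branchRank_le hG _ _)
  refine ⟨a, hdet, fun v hv => ?_⟩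
  obtain ⟨w, hvw⟩ := (ha.eq_or_exists_toward hG hsym v).resolve_left hv
  obtain ⟨p, q, hpq⟩ := exists_isLink_of_adj (P := P) hvw.1
  have hp : Toward G v (P.nbr v p) := hpq.1.symm ▸ hvw
  exact ⟨not_detects hG hsym (P.nbr v) hp (hcons.le_branchRank_of_ne hG hsym hp), p,
    hcons.lt_of_decided hG hsym hp (hdec v)⟩

end Network

/-! ### Asynchronous executions: conservation of pulses, termination, message count. -/

section Dynamics

variable {V : Type*} {G : SimpleGraph V} {P : PortNumbering G}
  {v w : V} {p : Fin (P.deg v)} {q : Fin (P.deg w)}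

/-- The number of pulses that a node has received at each of its ports. -/
def Config.received (c : Config P) (v : V) (p : Fin (P.deg v)) : ℕ :=
  (c.hist v).count p

theorem emitted_of_isLink [DecidableEq V] (h : IsLink P p q) (s : Fin (P.deg w) → ℕ) :
    emitted P w s v = s q := by
  rw [emitted, Finset.sum_eq_single q, if_pos h.2]
  · intro r _ hr
    exact if_neg fun h1 => hr ((P.nbr w).injective (Subtype.ext (h1.trans h.2.symm)))
  · simp

theorem sum_deg_add_two [Fintype V] (hG : G.IsTree) (P : PortNumbering G) :
    ∑ v, P.deg v + 2 = 2 * Fintype.card V := by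
  classical
  rw [← card_dart_add_two hG, Nat.card_eq_fintype_card, G.dart_card_eq_sum_degrees]
  congr 1
  refine Finset.sum_congr rfl fun v _ => ?_
  rw [← G.card_neighborSet_eq_degree, ← Fintype.card_congr (P.nbr v), Fintype.card_fin]

theorem halted_iff_decided [Fintype V] {c : Config P} :
    c.Halted (treeElection G) v ↔ Decided G (c.received v) := by
  classical
  change (ite _ _ _ : Option Output).isSome = true ↔ _
  split_ifs with h1 h2
  · exact iff_of_true rfl (Or.inl h1)
  · exact iff_of_true rfl (Or.inr h2)
  · exact iff_of_false Bool.false_ne_true fun h => h.elim h1 h2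

/-- Every pulse that the nodes have sent is in transit or has been received. -/
structure Conserves [Fintype V] (c : Config P) : Prop where
  transit_add : ∀ ⦃v w : V⦄ ⦃p : Fin (P.deg v)⦄ ⦃q : Fin (P.deg w)⦄, IsLink P p q →
    c.transit w v + c.received v p = target G (c.received w) q
  sent_eq : c.sent = ∑ v, ∑ q, target G (c.received v) q

theorem Conserves.consistent [Fintype V] {c : Config P} (hc : Conserves c) :
    Consistent P c.received :=
  fun _ _ _ _ h => hc.transit_add h ▸ Nat.le_add_left _ _

theorem Conserves.not_halted [Fintype V] {c : Config P} (hc : Conserves c) (hG : G.IsTree)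
    (hsym : ∀ u v, ¬ SymmetricAbout G u v) (hpos : 0 < c.transit (P.nbr v p) v) :
    ¬ c.Halted (treeElection G) v := by
  intro h
  obtain ⟨w, q, hpq⟩ := exists_isLink p
  have h1 := hc.consistent.target_le_of_decided hG hsym (halted_iff_decided.1 h) hpq
  have h2 := hc.transit_add hpq
  rw [hpq.1] at hpos
  omega

/-- The count is at most `(2n - 2)(2n + 1)`, whence the constant `4`. -/
theorem Conserves.sent_le [Fintype V] {c : Config P} (hc : Conserves c) (hG : G.IsTree) :
    c.sent ≤ 4 * Fintype.card V ^ 2 := by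
  have h1 : c.sent ≤ (∑ v, P.deg v) * (2 * Fintype.card V + 1) := by
    rw [hc.sent_eq, Finset.sum_mul]
    refine Finset.sum_le_sum fun v _ => ?_
    refine (Finset.sum_le_sum fun q _ => target_le hG).trans ?_
    simp
  have h2 := sum_deg_add_two hG P
  nlinarith

theorem received_initial [Fintype V] [DecidableEq V] (A : Algorithm) (v : V) :
    (initial A P).received v = fun _ => 0 :=
  rfl

theorem conserves_initial [Fintype V] [DecidableEq V] :
    Conserves (initial (treeElection G) P) where
  transit_add v w p q h := by
    rw [received_initial, received_initial, add_zero]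
    refine (emitted_of_isLink h _).trans ?_
    simp [treeElection]
  sent_eq := by
    simp only [received_initial]
    simp [treeElection, initial]

theorem deliver_hist [DecidableEq V] {A : Algorithm} {c : Config P} (h : ¬ c.Halted A v) :
    (deliver A c v p).hist = Function.update c.hist v (c.hist v ++ [p]) :=
  if_neg h

theorem received_deliver [DecidableEq V] {A : Algorithm} {c : Config P} (h : ¬ c.Halted A v) :
    (deliver A c v p).received v = fun r => (c.hist v ++ [p]).count r := by
  funext r
  rw [Config.received, deliver_hist h, Function.update_self]

theorem received_deliver_of_ne [DecidableEq V] {A : Algorithm} {c : Config P} (h : ¬ c.Halted A v)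
    (hw : w ≠ v) : (deliver A c v p).received w = c.received w := by
  funext r
  rw [Config.received, deliver_hist h, Function.update_of_ne hw]
  rfl

theorem target_add_send [Fintype V] [DecidableEq V] (hG : G.IsTree) {c : Config P}
    (h : ¬ c.Halted (treeElection G) v) (r : Fin (P.deg v)) :
    target G (c.received v) r + (treeElection G).send (P.deg v) (c.hist v ++ [p]) r =
      target G ((deliver (treeElection G) c v p).received v) r := by
  rw [received_deliver h]
  simp only [treeElection, List.append_eq_nil_iff, List.cons_ne_nil, and_false, if_false,
    List.dropLast_concat]
  -- The truncated subtraction in `send` is exact because the target cannot decrease at a node that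
  -- has not halted.
  refine Nat.add_sub_cancel' (target_mono hG (fun h1 => h (halted_iff_decided.2 (Or.inl h1))) ?_)
  intro q
  simp [Config.received]

theorem transit_deliver [DecidableEq V] {A : Algorithm} {c : Config P} (h : ¬ c.Halted A v)
    (a b : V) : (deliver A c v p).transit a b =
      (if a = (P.nbr v p : V) ∧ b = v then c.transit a b - 1 else c.transit a b) +
        if a = v then emitted P v (A.send (P.deg v) (c.hist v ++ [p])) b else 0 := by
  rw [← if_neg (show ¬ (c.output A v).isSome = true from h) (t := (0 : Fin (P.deg v) → ℕ))
    (e := A.send (P.deg v) (c.hist v ++ [p]))]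
  rfl

theorem sent_deliver [DecidableEq V] {A : Algorithm} {c : Config P} (h : ¬ c.Halted A v) :
    (deliver A c v p).sent = c.sent + ∑ q, A.send (P.deg v) (c.hist v ++ [p]) q := by
  rw [← if_neg (show ¬ (c.output A v).isSome = true from h) (t := (0 : Fin (P.deg v) → ℕ))
    (e := A.send (P.deg v) (c.hist v ++ [p]))]
  rfl

/-- The delivery affects a link into `v`, the emission only links out of `v`; these never coincide.
The recipient has not halted, so the pulse is recorded. -/
theorem Conserves.deliver [Fintype V] [DecidableEq V] {c : Config P} (hc : Conserves c)
    (hG : G.IsTree) (hsym : ∀ u v, ¬ SymmetricAbout G u v)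
    (hpos : 0 < c.transit (P.nbr v p) v) : Conserves (deliver (treeElection G) c v p) := by
  have h := hc.not_halted hG hsym hpos
  constructor
  · intro a b r s hrs
    have h1 := hc.transit_add hrs
    have hab : b ≠ a := fun hab => (P.nbr a r).2.ne (hrs.1.trans hab).symm
    rw [transit_deliver h]
    by_cases ha : a = v
    · subst ha
      rw [received_deliver_of_ne h hab, if_neg hab, ← h1, received_deliver h, Config.received]
      simp only [List.count_append, List.count_singleton, and_true]
      by_cases hr : r = p
      · subst hr
        rw [hrs.1] at hpos
        simp [hrs.1]
        omega
      · have hb : b ≠ P.nbr a p := fun hb =>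
          hr ((P.nbr a).injective (Subtype.ext (hrs.1.trans hb)))
        simp [hb, Ne.symm hr]
    · rw [if_neg fun h => ha h.2, received_deliver_of_ne h ha]
      by_cases hb : b = v
      · subst hb
        rw [if_pos rfl, emitted_of_isLink hrs, ← target_add_send hG h, ← h1]
        omega
      · rw [if_neg hb, received_deliver_of_ne h hb, ← h1, add_zero]
  · have h1 : ∀ w, ∑ r, target G ((ContentOblivious.deliver (treeElection G) c v p).received w) r =
        ∑ r, target G (c.received w) r + if w = v then
          ∑ r, (treeElection G).send (P.deg v) (c.hist v ++ [p]) r else 0 := by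
      intro w
      split_ifs with hw
      · subst hw
        simp only [← target_add_send hG h, Finset.sum_add_distrib]
      · rw [received_deliver_of_ne h hw, add_zero]
    simp only [h1, Finset.sum_add_distrib, ← hc.sent_eq, Finset.sum_ite_eq', Finset.mem_univ,
      if_true, sent_deliver h]

theorem Conserves.sum_length_le [Fintype V] {c : Config P} (hc : Conserves c) (hG : G.IsTree) :
    ∑ v, (c.hist v).length ≤ ∑ v, P.deg v * (2 * Fintype.card V + 1) := by
  refine Finset.sum_le_sum fun v _ => ?_
  have h1 : (c.hist v).length = ∑ p, c.received v p := by
    simpa [Config.received] using (Multiset.sum_count_eq_card (s := Finset.univ)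
      (m := Multiset.ofList (c.hist v)) fun _ _ => Finset.mem_univ _).symm
  rw [h1]
  refine (Finset.sum_le_card_nsmul _ _ (2 * Fintype.card V + 1) fun p _ => ?_).trans ?_
  · obtain ⟨w, q, hpq⟩ := exists_isLink p
    exact (hc.consistent hpq).trans (target_le hG)
  · simp

theorem sum_length_deliver [Fintype V] [DecidableEq V] {A : Algorithm} {c : Config P}
    (h : ¬ c.Halted A v) :
    ∑ w, ((deliver A c v p).hist w).length = ∑ w, (c.hist w).length + 1 := by
  have h1 : ∀ w, ((deliver A c v p).hist w).length =
      (c.hist w).length + if w = v then 1 else 0 := by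
    intro w
    rw [deliver_hist h]
    split_ifs with hw
    · subst hw
      simp
    · rw [Function.update_of_ne hw, add_zero]
  simp [h1, Finset.sum_add_distrib]

variable [Fintype V] [DecidableEq V]

theorem Execution.conserves (E : Execution (treeElection G) P) (hG : G.IsTree)
    (hsym : ∀ u v, ¬ SymmetricAbout G u v) (t : ℕ) : Conserves (E.config t) := by
  induction t with
  | zero => exact E.config_zero ▸ conserves_initial
  | succ t ih =>
    cases he : E.event t with
    | none => exact (E.config_idle t he).symm ▸ ih
    | some e =>
      obtain ⟨h1, h2⟩ := E.config_deliver t e.1 e.2 he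
      exact h2 ▸ ih.deliver hG hsym h1

theorem Execution.not_halted (E : Execution (treeElection G) P) (hG : G.IsTree)
    (hsym : ∀ u v, ¬ SymmetricAbout G u v) {t : ℕ} (he : E.event t = some ⟨v, p⟩) :
    ¬ (E.config t).Halted (treeElection G) v :=
  (E.conserves hG hsym t).not_halted hG hsym (E.config_deliver t v p he).1

theorem Execution.exists_forall_event_eq_none (E : Execution (treeElection G) P) (hG : G.IsTree)
    (hsym : ∀ u v, ¬ SymmetricAbout G u v) : ∃ t, ∀ t' ≥ t, E.event t' = none := by
  -- The total number of recorded pulses is bounded and grows at every delivery, so deliveries cease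
  -- once its maximum is attained.
  let f : ℕ → ℕ := fun t => ∑ v, ((E.config t).hist v).length
  have hsome : ∀ t e, E.event t = some e → f (t + 1) = f t + 1 := by
    intro t e he
    simp only [f, (E.config_deliver t e.1 e.2 he).2]
    exact sum_length_deliver (E.not_halted hG hsym he)
  have hmono : Monotone f := by
    refine monotone_nat_of_le_succ fun t => ?_
    cases he : E.event t with
    | none => simp only [f, E.config_idle t he, le_refl]
    | some e => exact hsome t e he ▸ Nat.le_succ _
  have hbdd : BddAbove (Set.range f) := by
    refine ⟨∑ v, P.deg v * (2 * Fintype.card V + 1), ?_⟩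
    rintro _ ⟨t, rfl⟩
    exact (E.conserves hG hsym t).sum_length_le hG
  obtain ⟨t, ht⟩ := Nat.sSup_mem (Set.range_nonempty f) hbdd
  refine ⟨t, fun t' ht' => ?_⟩
  cases he : E.event t' with
  | none => rfl
  | some e =>
    have h1 := le_csSup hbdd ⟨t' + 1, rfl⟩
    have h2 := hmono ht'
    have h3 := hsome t' e he
    omega

theorem Execution.exists_forall_received_eq_target (E : Execution (treeElection G) P)
    (hG : G.IsTree) (hsym : ∀ u v, ¬ SymmetricAbout G u v) :
    ∃ t, ∀ ⦃v w : V⦄ ⦃p : Fin (P.deg v)⦄ ⦃q : Fin (P.deg w)⦄, IsLink P p q →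
      (E.config t).received v p = target G ((E.config t).received w) q := by
  obtain ⟨t, ht⟩ := E.exists_forall_event_eq_none hG hsym
  refine ⟨t, fun v w p q hpq => ?_⟩
  have h1 := (E.conserves hG hsym t).transit_add hpq
  rcases Nat.eq_zero_or_pos ((E.config t).transit w v) with h2 | h2
  · rwa [h2, zero_add] at h1
  · rw [← hpq.1] at h2
    obtain ⟨t', ht', he⟩ := E.eventually_delivered t v p h2
    simp [ht t' ht'] at he

theorem treeElection_correct (E : Execution (treeElection G) P) (hG : G.IsTree)
    (hsym : ∀ u v, ¬ SymmetricAbout G u v) :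
    E.ElectsLeader ∧ E.QuiescentlyTerminates ∧ E.PulsesAtMost (4 * Fintype.card V ^ 2) := by
  obtain ⟨t, ht⟩ := E.exists_forall_received_eq_target hG hsym
  obtain ⟨a, ha, hne⟩ := exists_detects_of_forall_eq_target hG hsym ht
  have hleader : (E.config t).output (treeElection G) a = some Output.leader := if_pos ha
  have hnonLeader : ∀ v ≠ a, (E.config t).output (treeElection G) v = some Output.nonLeader :=
    fun v hv => (if_neg (hne v hv).1).trans (if_pos (hne v hv).2)
  refine ⟨⟨t, a, hleader, hnonLeader⟩, ⟨⟨t, fun v => ?_⟩, fun t v p => E.not_halted hG hsym⟩,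
    fun t => (E.conserves hG hsym t).sent_le hG⟩
  by_cases hv : v = a
  · subst hv
    rw [Config.Halted, hleader]
    rfl
  · rw [Config.Halted, hnonLeader v hv]
    rfl

end Dynamics

end ContentOblivious

/-- The algorithm `A n K` that all nodes run depends only on a graph `K` with vertex set
`{0, …, n - 1}` that is isomorphic to the network `G`: this is the topology knowledge, the same for
all nodes. The nodes have no identifiers, and `K` does not tell a node its position in `G`. -/
theorem mainTheorem1 :
    ∃ (A : (n : ℕ) → SimpleGraph (Fin n) → ContentOblivious.Algorithm) (C : ℕ),
      ∀ (n : ℕ) (K : SimpleGraph (Fin n))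
        (V : Type*) [Fintype V] [DecidableEq V] (G : SimpleGraph V)
        (P : ContentOblivious.PortNumbering G),
        Nonempty (G ≃g K) →
        G.IsTree →
        (∀ u v : V, ¬ ContentOblivious.SymmetricAbout G u v) →
        ∀ E : ContentOblivious.Execution (A n K) P,
          E.ElectsLeader ∧ E.QuiescentlyTerminates ∧ E.PulsesAtMost (C * n ^ 2) := by
  refine ⟨fun _ K => ContentOblivious.treeElection K, 4, ?_⟩
  rintro n K V _ _ G P ⟨φ⟩ hG hsym
  have hn : Fintype.card V = n := (Fintype.card_congr φ.toEquiv).trans (Fintype.card_fin n)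
  dsimp only
  rw [ContentOblivious.treeElection_iso φ, ← hn]
  exact fun E => ContentOblivious.treeElection_correct E hG hsym
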